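/- Let $k\ge 2$ be an integer, let $\mathbb N=\{0,1,2,\dots\}$, and let $\mathbb N_\infty=\mathbb N\cup\{\infty\}$ be the semiring of extended non-negative integers, with $a+\infty=\infty$, $a\cdot\infty=\infty$ for $a\neq 0$, and $0\cdot\infty=0$. A sequence $\mathbf x=x(0)x(1)x(2)\cdots$ is $k$-automatic if some deterministic finite automaton with output, reading the canonical base-$k$ expansion of $n$, outputs $x(n)$ for every $n\ge 0$. For a semiring $R$, a sequence $f:\mathbb N\to R$ is $(R,k)$-regular if there are finitely many sequences $f_1,\dots,f_r:\mathbb N\to R$ such that $f$ is an $R$-linear combination of $f_1,\dots,f_r$ and, for all $1\le i\le r$ and $0\le a<k$, the sequence $(f_i(kn+a))_{n\ge 0}$ is an $R$-linear combination of $f_1,\dots,f_r$. For an infinite word $\mathbf x$ and $n\ge 0$, define the following elements of $\mathbb N_\infty$ (a minimum over the empty set is $\infty$): - the recurrence function $R_{\mathbf x}(n)$, the least $t$ such that every factor of length $t$ of $\mathbf x$ contains every factor of length $n$ of $\mathbf x$ as a factor; - the appearance function $A_{\mathbf x}(n)$, the least $t$ such that every factor of length $n$ of $\mathbf x$ appears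 in the prefix of length $t$ of $\mathbf x$; - the separator length $S_{\mathbf x}(n)$, for $n\ge 1$, the length of the shortest factor that begins at position $n$ of $\mathbf x$ and does not begin at any position $j<n$; the value $S_{\mathbf x}(0)$ may be any fixed element of $\mathbb N$ (or of $\mathbb N_\infty$, where regularity over $\mathbb N_\infty$ is concerned); - the repetitivity index $I_{\mathbf x}(n)$, the minimum distance between two consecutive occurrences in $\mathbf x$ of the same factor of length $n$. **Theorem.** Let $\mathbf x$ be $k$-automatic. Then: 1. $(R_{\mathbf x}(n))_{n\ge 0}$ is $(\mathbb N_\infty,k)$-regular. 2. $A_{\mathbf x}(n)$ is finite for all $n$, and $(A_{\mathbf x}(n))_{n\ge 0}$ is $(\mathbb N,k)$-regular. 3. $(S_{\mathbf x}(n))_{n\ge 0}$ is $(\mathbb N_\infty,k)$-regular; if $\mathbf x$ is not ultimately periodic, then $S_{\mathbf x}(n)$ is finite for all $n$, and $(S_{\mathbf x}(n))_{n\ge 0}$ is $(\mathbb N,k)$-regular. 4. $I_{\mathbf x}(n)$ is finite for all $n$, and $(I_{\mathbf x}(n))_{n\ge 0}$ is $(\mathbb N,k)$-regular. -/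

import Mathlib

/-- The integer `[w]_k` represented in base `k` by the word `w` (most significant digit first). -/
def baseValue (k : ℕ) (w : List (Fin k)) : ℕ :=
  w.foldl (fun m d => k * m + (d : ℕ)) 0

/-- `w` is a canonical base-`k` expansion: it is empty or its first digit is nonzero. -/
def IsCanonicalExpansion (k : ℕ) (w : List (Fin k)) : Prop :=
  ∀ d ∈ w.head?, (d : ℕ) ≠ 0

/-- `x` is `k`-automatic: it is computed by a deterministic finite automaton with output
(finite state set `σ`, initial state `q₀`, transition function `δ`, output map `τ`) that reads
the canonical base-`k` expansion of `n` and outputs `x n`. -/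
def IsAutomatic {Δ : Type*} (k : ℕ) (x : ℕ → Δ) : Prop :=
  ∃ (σ : Type) (_ : Finite σ) (q₀ : σ) (δ : σ → Fin k → σ) (τ : σ → Δ),
    ∀ w : List (Fin k), IsCanonicalExpansion k w → x (baseValue k w) = τ (w.foldl δ q₀)

/-- `f` is `(R, k)`-regular: there are finitely many sequences `F 0, …, F (r - 1)` such that
`f` is an `R`-linear combination of them, and each `n ↦ F i (k n + a)` with `0 ≤ a < k` is an
`R`-linear combination of them as well. -/
def IsRegularSeq (R : Type*) [Semiring R] (k : ℕ) (f : ℕ → R) : Prop :=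
  ∃ (r : ℕ) (F : Fin r → ℕ → R),
    f ∈ Submodule.span R (Set.range F) ∧
      ∀ i : Fin r, ∀ a : ℕ, a < k →
        (fun n => F i (k * n + a)) ∈ Submodule.span R (Set.range F)

/-- The factor `x[i..i+n-1]` of length `n` that begins at position `i` of the infinite word `x`. -/
def factorAt {Δ : Type*} (x : ℕ → Δ) (i n : ℕ) : List Δ :=
  (List.range n).map fun m => x (i + m)

/-- The least element of a set of natural numbers, and `∞` if the set is empty. -/
noncomputable def leastOrTop (S : Set ℕ) : ℕ∞ :=
  sInf ((fun t : ℕ => (t : ℕ∞)) '' S)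

/-- The recurrence function: the least `t` such that every factor of length `t` of `x`
contains every factor of length `n` of `x` as a factor. -/
noncomputable def recurrenceFunction {Δ : Type*} (x : ℕ → Δ) (n : ℕ) : ℕ∞ :=
  leastOrTop {t : ℕ | ∀ i j : ℕ, factorAt x j n <:+: factorAt x i t}

/-- The appearance function: the least `t` such that every factor of length `n` of `x`
appears in the prefix of length `t` of `x`. -/
noncomputable def appearanceFunction {Δ : Type*} (x : ℕ → Δ) (n : ℕ) : ℕ∞ :=
  leastOrTop {t : ℕ | ∀ j : ℕ, factorAt x j n <:+: factorAt x 0 t}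

/-- The separator length: the least length of a factor that begins at position `n` of `x` and
does not occur at any earlier position. -/
noncomputable def separatorLength {Δ : Type*} (x : ℕ → Δ) (n : ℕ) : ℕ∞ :=
  leastOrTop {t : ℕ | ∀ j < n, factorAt x j t ≠ factorAt x n t}

/-- The repetitivity index: the least distance between two consecutive occurrences, at
positions `i < j`, of the same factor of length `n`. -/
noncomputable def repetitivityIndex {Δ : Type*} (x : ℕ → Δ) (n : ℕ) : ℕ∞ :=
  leastOrTop {d : ℕ | ∃ i j : ℕ, i < j ∧ j = i + d ∧ factorAt x j n = factorAt x i n ∧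
    ∀ m : ℕ, i < m → m < j → factorAt x m n ≠ factorAt x i n}

/-- `x` is ultimately periodic. -/
def IsUltimatelyPeriodic {Δ : Type*} (x : ℕ → Δ) : Prop :=
  ∃ p N : ℕ, 0 < p ∧ ∀ n : ℕ, N ≤ n → x (n + p) = x n

/-!
Read the base-`k` expansions of several numbers in parallel. The predicates that a finite automaton
decides in this way are closed under first-order logic, and they include linear inequalities and,
for automatic `x`, the relation `x u = x w`. Hence each of the four functions has the form
`n ↦ min {t | P n t}` with such a predicate `P`. This minimum is the number of `s` that are smaller
than every `t` with `P n t`, again a decidable condition on `(n, s)`. Sorting the `s` by their last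
digit shows that the number of solutions `s` of a decidable condition is regular over `ℕ∞`, since
the condition has only finitely many variants under appending digits.

If the values are finite, then a coefficient `∞` can only multiply `0` and a sequence with an
infinite value can only be multiplied by `0`, so regularity descends from `ℕ∞` to `ℕ`. Finiteness
itself comes from the pigeonhole principle: `x` has finitely many factors of each length.
-/

variable {k : ℕ}

section Recognizable

variable {ι κ : Type*}

/-- Append the digit `d i` to the base-`k` expansion of `v i`, for all `i` at once. -/
def appendDigits (v : ι → ℕ) (d : ι → Fin k) : ι → ℕ := fun i => k * v i + d i

/-- `P` has a finite `k`-kernel, that is, it belongs to a finite set of predicates closed under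
`Q ↦ fun v => Q (appendDigits v d)`. Equivalently, a finite automaton decides `P v` by reading the
base-`k` expansions of all `v i` in parallel, least significant digits first. The index type `ι`
plays the role of the set of free variables of a first-order formula. -/
def IsRecognizable (k : ℕ) (P : (ι → ℕ) → Prop) : Prop :=
  ∃ K : Set ((ι → ℕ) → Prop), K.Finite ∧ P ∈ K ∧
    ∀ Q ∈ K, ∀ d : ι → Fin k, (fun v => Q (appendDigits v d)) ∈ K

theorem map_appendDigits (f : (ι → ℕ) →+ ℤ) (v : ι → ℕ) (d : ι → Fin k) :
    f (appendDigits v d) = k * f v + f fun i => (d i : ℕ) := by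
  have : appendDigits v d = k • v + fun i => (d i : ℕ) := rfl
  rw [this, map_add, map_nsmul, nsmul_eq_mul]

theorem exists_nat_iff_exists_mul_add_fin [NeZero k] {p : ℕ → Prop} :
    (∃ n, p n) ↔ ∃ m, ∃ b : Fin k, p (k * m + b) :=
  ⟨fun ⟨n, hn⟩ => ⟨n / k, Fin.ofNat k n, by simpa [Nat.div_add_mod] using hn⟩,
    fun ⟨_, _, h⟩ => ⟨_, h⟩⟩

namespace IsRecognizable

theorem not {P : (ι → ℕ) → Prop} (hP : IsRecognizable k P) :
    IsRecognizable k fun v => ¬ P v := by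
  obtain ⟨K, hK, hPK, hdigit⟩ := hP
  refine ⟨(fun Q v => ¬ Q v) '' K, hK.image _, ⟨P, hPK, rfl⟩, ?_⟩
  rintro _ ⟨Q, hQ, rfl⟩ d
  exact ⟨_, hdigit Q hQ d, rfl⟩

theorem and {P Q : (ι → ℕ) → Prop} (hP : IsRecognizable k P) (hQ : IsRecognizable k Q) :
    IsRecognizable k fun v => P v ∧ Q v := by
  obtain ⟨K, hK, hPK, hKdigit⟩ := hP
  obtain ⟨L, hL, hQL, hLdigit⟩ := hQ
  refine ⟨Set.image2 (fun P Q v => P v ∧ Q v) K L, hK.image2 _ hL, ⟨P, hPK, Q, hQL, rfl⟩, ?_⟩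
  rintro _ ⟨P', hP', Q', hQ', rfl⟩ d
  exact ⟨_, hKdigit P' hP' d, _, hLdigit Q' hQ' d, rfl⟩

theorem imp {P Q : (ι → ℕ) → Prop} (hP : IsRecognizable k P) (hQ : IsRecognizable k Q) :
    IsRecognizable k fun v => P v → Q v := by
  simpa only [not_and, not_not] using (hP.and hQ.not).not

theorem reindex {P : (κ → ℕ) → Prop} (hP : IsRecognizable k P) (g : κ → ι) :
    IsRecognizable k fun v : ι → ℕ => P fun j => v (g j) := by
  obtain ⟨K, hK, hPK, hdigit⟩ := hP
  refine ⟨(fun Q v => Q fun j => v (g j)) '' K, hK.image _, ⟨P, hPK, rfl⟩, ?_⟩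
  rintro _ ⟨Q, hQ, rfl⟩ d
  exact ⟨_, hdigit Q hQ fun j => d (g j), rfl⟩

-- Subset construction: guessing the digits of `n` leads to a set of predicates, one of which must
-- hold, and a finite set of predicates has finitely many subsets. The bound variable is `none`, the
-- free variables are `some i`.
theorem ex [NeZero k] {P : (ι → ℕ) → ℕ → Prop}
    (hP : IsRecognizable k fun v : Option ι → ℕ => P (fun i => v (some i)) (v none)) :
    IsRecognizable k fun v => ∃ n, P v n := by
  obtain ⟨K, hK, hPK, hdigit⟩ := hP
  refine ⟨(fun S v => ∃ n, ∃ Q ∈ S, Q (Option.elim · n v)) '' 𝒫 K, hK.finite_subsets.image _,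
    ⟨_, Set.singleton_subset_iff.2 hPK, by simp⟩, ?_⟩
  rintro _ ⟨S, hSK, rfl⟩ d
  refine ⟨Set.image2 (fun Q (b : Fin k) v => Q (appendDigits v (Option.elim · b d))) S Set.univ,
    ?_, funext fun v => propext ?_⟩
  · rintro _ ⟨Q, hQ, b, -, rfl⟩
    exact hdigit Q (hSK hQ) _
  · have append_elim (n : ℕ) (b : Fin k) : (Option.elim · (k * n + b) (appendDigits v d)) =
        appendDigits (Option.elim · n v) (Option.elim · b d) := by
      ext (_ | i) <;> rfl
    beta_reduce
    rw [exists_nat_iff_exists_mul_add_fin (k := k) (p := fun n => ∃ Q ∈ S, Q (Option.elim · n _))]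
    simp only [Set.exists_mem_image2, Set.mem_univ, true_and, append_elim]
    exact exists_congr fun n => ⟨fun ⟨Q, hQ, b, h⟩ => ⟨b, Q, hQ, h⟩,
      fun ⟨b, Q, hQ, h⟩ => ⟨Q, hQ, b, h⟩⟩

theorem all [NeZero k] {P : (ι → ℕ) → ℕ → Prop}
    (hP : IsRecognizable k fun v : Option ι → ℕ => P (fun i => v (some i)) (v none)) :
    IsRecognizable k fun v => ∀ n, P v n := by
  simpa only [not_exists, not_not] using (ex (P := fun v n => ¬ P v n) hP.not).not

variable [Finite ι] [k.AtLeastTwo]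

-- Appending digits `d` turns the bound `c` into `⌊(c - f d) / k⌋`, so the bounds that occur stay in
-- an interval: if `|f d| ≤ B` and `|c| ≤ B`, then `|c - f d| ≤ 2 * B ≤ k * B`.
theorem map_le (f : (ι → ℕ) →+ ℤ) (b : ℤ) : IsRecognizable k fun v => f v ≤ b := by
  have hk : (2 : ℤ) ≤ k := mod_cast Nat.AtLeastTwo.prop
  obtain ⟨D, hD⟩ := (Set.finite_range fun d : ι → Fin k => |f fun i => (d i : ℕ)|).bddAbove
  set B := max D |b|
  refine ⟨(fun c v => f v ≤ c) '' Set.Icc (-B) B, (Set.finite_Icc _ _).image _,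
    ⟨b, abs_le.1 (le_max_right _ _), rfl⟩, ?_⟩
  rintro _ ⟨c, ⟨hBc, hcB⟩, rfl⟩ d
  obtain ⟨hBd, hdB⟩ := abs_le.1 ((hD ⟨d, rfl⟩).trans (le_max_left D |b|))
  have hkB : 2 * B ≤ k * B := mul_le_mul_of_nonneg_right hk (by linarith)
  refine ⟨(c - f fun i => (d i : ℕ)) / k, ⟨?_, ?_⟩, funext fun v => propext ?_⟩
  · rw [Int.le_ediv_iff_mul_le (by linarith)]
    linarith
  · exact Int.ediv_le_of_le_mul (by linarith) (by linarith)
  · beta_reduce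
    rw [Int.le_ediv_iff_mul_le (by linarith), map_appendDigits, le_sub_iff_add_le, mul_comm]

theorem sum_le_sum (s t : List ι) :
    IsRecognizable k fun v => (s.map v).sum ≤ (t.map v).sum := by
  let f : (ι → ℕ) →+ ℤ :=
    { toFun v := ((s.map v).sum : ℕ) - ((t.map v).sum : ℕ)
      map_zero' := by simp [Pi.zero_def, -Nat.cast_list_sum]
      map_add' v w := by
        simp only [Pi.add_def, List.sum_map_add, Nat.cast_add]
        ring }
  simpa only [f, AddMonoidHom.coe_mk, ZeroHom.coe_mk, sub_nonpos, Nat.cast_le] using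
    map_le (k := k) f 0

theorem sum_lt_sum (s t : List ι) :
    IsRecognizable k fun v => (s.map v).sum < (t.map v).sum := by
  simpa only [not_le] using (sum_le_sum t s).not

theorem sum_eq_sum (s t : List ι) :
    IsRecognizable k fun v => (s.map v).sum = (t.map v).sum := by
  simpa only [le_antisymm_iff] using (sum_le_sum s t).and (sum_le_sum t s)

end IsRecognizable

end Recognizable

section Automatic

variable [k.AtLeastTwo]

/-- The canonical base-`k` expansion of `n`, most significant digit first. -/
def canonicalExpansion (k : ℕ) [NeZero k] (n : ℕ) : List (Fin k) :=
  (Nat.digits k n).reverse.map (Fin.ofNat k)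

theorem baseValue_canonicalExpansion (n : ℕ) : baseValue k (canonicalExpansion k n) = n := by
  conv_rhs => rw [← Nat.ofDigits_digits k n, Nat.ofDigits_eq_foldr]
  simp only [baseValue, canonicalExpansion, List.bind_eq_flatMap, List.pure_def,
    ← List.map_eq_flatMap, List.foldl_map, List.foldl_reverse]
  refine List.foldr_ext _ _ _ fun d hd m => ?_
  simp [Nat.mod_eq_of_lt (Nat.digits_lt_base Nat.AtLeastTwo.one_lt hd), add_comm]

theorem isCanonicalExpansion_canonicalExpansion (n : ℕ) :
    IsCanonicalExpansion k (canonicalExpansion k n) := by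
  intro d hd
  obtain ⟨a, ha, rfl⟩ : ∃ a ∈ (Nat.digits k n).getLast?, Fin.ofNat k a = d := by
    simpa [canonicalExpansion] using hd
  obtain ⟨hne, rfl⟩ := List.mem_getLast?_eq_getLast ha
  have hlt := Nat.digits_lt_base Nat.AtLeastTwo.one_lt (List.getLast_mem hne)
  rw [Fin.val_ofNat, Nat.mod_eq_of_lt hlt]
  exact Nat.getLast_digit_ne_zero k (Nat.digits_ne_nil_iff_ne_zero.1 hne)

theorem canonicalExpansion_mul_add {n : ℕ} {a : Fin k} (h : k * n + a ≠ 0) :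
    canonicalExpansion k (k * n + a) = canonicalExpansion k n ++ [a] := by
  have hdigits : Nat.digits k (k * n + a) = (a : ℕ) :: Nat.digits k n := by
    rw [add_comm]
    refine Nat.digits_add k Nat.AtLeastTwo.one_lt a n a.isLt ?_
    contrapose! h
    simp [h]
  simp [canonicalExpansion, hdigits]

namespace IsAutomatic

variable {Δ : Type*} {x : ℕ → Δ}

theorem exists_states (hx : IsAutomatic k x) :
    ∃ (σ : Type) (_ : Finite σ) (s : ℕ → σ) (δ : σ → Fin k → σ) (τ : σ → Δ),
      (∀ n (a : Fin k), s (k * n + a) = δ (s n) a) ∧ x = τ ∘ s := by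
  classical
  obtain ⟨σ, _, q₀, δ, τ, hτ⟩ := hx
  -- The first component records that only leading zeros have been read.
  refine ⟨Prop × σ, inferInstance, fun n => (n = 0, (canonicalExpansion k n).foldl δ q₀),
    fun q a => if q.1 ∧ a = 0 then q else (False, δ q.2 a), fun q => τ q.2, fun n a => ?_,
    funext fun n => ?_⟩
  · by_cases h : n = 0 ∧ a = 0
    · simp [h]
    · have hne : k * n + a ≠ 0 := by simpa [NeZero.ne k] using h
      simp only [h, hne, canonicalExpansion_mul_add hne, List.foldl_append, List.foldl_cons,
        List.foldl_nil, if_false]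
  · simpa only [baseValue_canonicalExpansion, Function.comp_apply] using
      hτ _ (isCanonicalExpansion_canonicalExpansion n)

theorem finite_range (hx : IsAutomatic k x) : (Set.range x).Finite := by
  obtain ⟨σ, _, s, δ, τ, -, rfl⟩ := hx.exists_states
  exact (Set.finite_range τ).subset (Set.range_comp_subset_range s τ)

-- The automaton of `x` reads most significant digits first, so it has to be reversed: the kernel
-- consists of the predicates `fun v => s ∘ v ∈ A` for the finitely many sets `A` of state tuples.
theorem isRecognizable_comp {ι : Type*} [Finite ι] (hx : IsAutomatic k x) (r : (ι → Δ) → Prop) :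
    IsRecognizable k fun v => r (x ∘ v) := by
  obtain ⟨σ, _, s, δ, τ, hδ, rfl⟩ := hx.exists_states
  refine ⟨Set.range fun (A : Set (ι → σ)) v => s ∘ v ∈ A, Set.finite_range _,
    ⟨{q | r (τ ∘ q)}, rfl⟩, ?_⟩
  rintro _ ⟨A, rfl⟩ d
  refine ⟨{q | (fun i => δ (q i) (d i)) ∈ A}, funext fun v => ?_⟩
  have hstep : s ∘ appendDigits v d = fun i => δ (s (v i)) (d i) := funext fun i => hδ _ _
  simp only [hstep]
  rfl

end IsAutomatic

end Automatic

section Regular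

variable {R : Type*} [Semiring R]

theorem isRegularSeq_iff_exists_finite_set {f : ℕ → R} :
    IsRegularSeq R k f ↔ ∃ K : Set (ℕ → R), K.Finite ∧ f ∈ Submodule.span R K ∧
      ∀ g ∈ K, ∀ a < k, (fun n => g (k * n + a)) ∈ Submodule.span R K := by
  constructor
  · rintro ⟨r, F, hf, hF⟩
    exact ⟨Set.range F, Set.finite_range F, hf, Set.forall_mem_range.2 hF⟩
  · rintro ⟨K, hK, hf, hdigit⟩
    obtain ⟨r, F, rfl⟩ := hK.fin_embedding
    exact ⟨r, F, hf, Set.forall_mem_range.1 hdigit⟩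

theorem IsRegularSeq.add {f g : ℕ → R} (hf : IsRegularSeq R k f) (hg : IsRegularSeq R k g) :
    IsRegularSeq R k (f + g) := by
  rw [isRegularSeq_iff_exists_finite_set] at *
  obtain ⟨K, hK, hfK, hKdigit⟩ := hf
  obtain ⟨L, hL, hgL, hLdigit⟩ := hg
  have hKL := Submodule.span_mono (R := R) (Set.subset_union_left (s := K) (t := L))
  have hLK := Submodule.span_mono (R := R) (Set.subset_union_right (s := K) (t := L))
  refine ⟨K ∪ L, hK.union hL, add_mem (hKL hfK) (hLK hgL), ?_⟩
  rintro h (hh | hh) a ha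
  · exact hKL (hKdigit h hh a ha)
  · exact hLK (hLdigit h hh a ha)

theorem isRegularSeq_single_zero (c : R) : IsRegularSeq R k (Pi.single 0 c) := by
  refine isRegularSeq_iff_exists_finite_set.2 ⟨{(Pi.single 0 1 : ℕ → R)}, Set.finite_singleton _,
    Submodule.mem_span_singleton.2 ⟨c, by simp [← Pi.single_smul]⟩, ?_⟩
  rintro _ rfl a ha
  rcases Nat.eq_zero_or_pos a with rfl | ha₀
  · convert Submodule.mem_span_singleton_self (R := R) (Pi.single 0 1 : ℕ → R) using 1
    ext n
    simp [Pi.single_apply, ha.ne']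
  · convert Submodule.zero_mem _ using 1
    ext n
    simp [ha₀.ne']

theorem mem_span_nat_of_natCast_mem_span {X : Type*} {K : Set (X → ℕ∞)} {f : X → ℕ}
    (hf : (fun n => (f n : ℕ∞)) ∈ Submodule.span ℕ∞ K) :
    f ∈ Submodule.span ℕ {h : X → ℕ | (fun n => (h n : ℕ∞)) ∈ K} := by
  generalize hg : (fun n => (f n : ℕ∞)) = g at hf
  induction hf using Submodule.span_induction generalizing f with
  | mem g hgK => exact Submodule.subset_span (by simpa [hg] using hgK)
  | zero =>
    obtain rfl : f = 0 := funext fun n => by simpa using congrFun hg n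
    exact zero_mem _
  | add g₁ g₂ _ _ ih₁ ih₂ =>
    have hsum n : (f n : ℕ∞) = g₁ n + g₂ n := congrFun hg n
    have htop n : g₁ n ≠ ⊤ ∧ g₂ n ≠ ⊤ :=
      WithTop.add_ne_top.1 (hsum n ▸ ENat.natCast_ne_top (f n))
    lift g₁ to X → ℕ using fun n => (htop n).1
    lift g₂ to X → ℕ using fun n => (htop n).2
    obtain rfl : f = g₁ + g₂ := funext fun n => Nat.cast_injective (R := ℕ∞) (by simpa using hsum n)
    exact add_mem (ih₁ rfl) (ih₂ rfl)
  | smul c g _ ih =>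
    have hmul n : (f n : ℕ∞) = c * g n := congrFun hg n
    rcases eq_or_ne f 0 with rfl | hne
    · exact zero_mem _
    · obtain ⟨m, hm⟩ := Function.ne_iff.1 hne
      have hcg : c ≠ 0 ∧ g m ≠ 0 := by
        rw [← mul_ne_zero_iff, ← hmul]
        exact_mod_cast hm
      have hc : c ≠ ⊤ := by
        rintro rfl
        exact ENat.natCast_ne_top _ ((hmul m).trans (ENat.top_mul hcg.2))
      have hgfin n : g n ≠ ⊤ := fun h =>
        ENat.natCast_ne_top (f n) (by rw [hmul, h, ENat.mul_top hcg.1])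
      lift c to ℕ using hc
      lift g to X → ℕ using hgfin
      obtain rfl : f = c • g := funext fun n => Nat.cast_injective (R := ℕ∞) (by simpa using hmul n)
      exact Submodule.smul_mem _ c (ih rfl)

theorem IsRegularSeq.of_natCast {f : ℕ → ℕ} (hf : IsRegularSeq ℕ∞ k fun n => (f n : ℕ∞)) :
    IsRegularSeq ℕ k f := by
  rw [isRegularSeq_iff_exists_finite_set] at *
  obtain ⟨K, hK, hfK, hdigit⟩ := hf
  refine ⟨{h | (fun n => (h n : ℕ∞)) ∈ K}, hK.preimage ?_, mem_span_nat_of_natCast_mem_span hfK,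
    fun g hg a ha => mem_span_nat_of_natCast_mem_span (hdigit _ hg a ha)⟩
  exact (Function.Injective.comp_left Nat.cast_injective).injOn

theorem IsRegularSeq.exists_natCast_eq {f : ℕ → ℕ∞} (hf : IsRegularSeq ℕ∞ k f)
    (hfin : ∀ n, f n ≠ ⊤) : ∃ g : ℕ → ℕ, (∀ n, f n = g n) ∧ IsRegularSeq ℕ k g := by
  lift f to ℕ → ℕ using hfin
  exact ⟨f, fun _ => rfl, hf.of_natCast⟩

theorem encard_setOf_eq_sum_mul_add [NeZero k] (p : ℕ → Prop) :
    {m | p m}.encard = ∑ b : Fin k, {m | p (k * m + b)}.encard := by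
  have hunion : {m | p m} = ⋃ b : Fin k, {m | p m ∧ Fin.ofNat k m = b} := by
    ext m
    simp
  have himage (b : Fin k) :
      {m | p m ∧ Fin.ofNat k m = b} = (k * · + (b : ℕ)) '' {m | p (k * m + b)} := by
    ext m
    constructor
    · rintro ⟨hm, rfl⟩
      exact ⟨m / k, by simpa [Nat.div_add_mod] using hm, by simp [Nat.div_add_mod]⟩
    · rintro ⟨m, hm, rfl⟩
      exact ⟨hm, by ext; simp [Nat.mod_eq_of_lt b.isLt]⟩
  rw [hunion, Set.encard_iUnion_of_finite, finsum_eq_sum_of_fintype]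
  · refine Finset.sum_congr rfl fun b _ => ?_
    rw [himage, Function.Injective.encard_image]
    exact fun m n h => by simpa [NeZero.ne k] using h
  · exact fun b c hbc => Set.disjoint_left.2 fun m hb hc => hbc (hb.2.symm.trans hc.2)

theorem IsRecognizable.isRegularSeq_encard [NeZero k] {P : ℕ → ℕ → Prop}
    (hP : IsRecognizable k fun v : Fin 2 → ℕ => P (v 0) (v 1)) :
    IsRegularSeq ℕ∞ k fun n => {m | P n m}.encard := by
  obtain ⟨K, hK, hPK, hdigit⟩ := hP
  let count (Q : (Fin 2 → ℕ) → Prop) (n : ℕ) : ℕ∞ := {m | Q ![n, m]}.encard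
  refine isRegularSeq_iff_exists_finite_set.2
    ⟨count '' K, hK.image _, Submodule.subset_span ⟨_, hPK, rfl⟩, ?_⟩
  rintro _ ⟨Q, hQ, rfl⟩ a ha
  have hcount : (fun n => count Q (k * n + a)) =
      ∑ b : Fin k, count fun v => Q (appendDigits v ![(⟨a, ha⟩ : Fin k), b]) := by
    ext1 n
    have happend (m : ℕ) (b : Fin k) :
        appendDigits ![n, m] ![(⟨a, ha⟩ : Fin k), b] = ![k * n + a, k * m + b] := by
      ext i
      fin_cases i <;> rfl
    simp only [count, Finset.sum_apply, happend]
    exact encard_setOf_eq_sum_mul_add _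
  rw [hcount]
  exact Submodule.sum_mem _ fun b _ => Submodule.subset_span ⟨_, hdigit Q hQ _, rfl⟩

end Regular

section LeastOrTop

theorem leastOrTop_ne_top {S : Set ℕ} (hS : S.Nonempty) : leastOrTop S ≠ ⊤ :=
  have ⟨t, ht⟩ := hS
  ne_top_of_le_ne_top (ENat.natCast_ne_top t) (sInf_le ⟨t, ht, rfl⟩)

theorem leastOrTop_eq_of_isLeast {S : Set ℕ} {t : ℕ} (h : IsLeast S t) : leastOrTop S = t :=
  ((Nat.mono_cast (α := ℕ∞)).map_isLeast h).isGLB.sInf_eq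

theorem leastOrTop_eq_encard (S : Set ℕ) : leastOrTop S = {s | ∀ t, t ∈ S → s < t}.encard := by
  rcases S.eq_empty_or_nonempty with rfl | hS
  · simp [leastOrTop]
  · have hleast : IsLeast S (sInf S) := ⟨Nat.sInf_mem hS, fun _ => Nat.sInf_le⟩
    have hIio : {s | ∀ t, t ∈ S → s < t} = Set.Iio (sInf S) :=
      Set.ext fun s => ⟨fun h => h _ hleast.1, fun h t ht => h.trans_le (hleast.2 ht)⟩
    rw [leastOrTop_eq_of_isLeast hleast, hIio, ← Finset.coe_Iio, Set.encard_coe_eq_coe_finsetCard,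
      Nat.card_Iio]

theorem IsRecognizable.isRegularSeq_leastOrTop [k.AtLeastTwo] {P : ℕ → ℕ → Prop}
    (hP : IsRecognizable k fun v : Fin 2 → ℕ => P (v 0) (v 1)) :
    IsRegularSeq ℕ∞ k fun n => leastOrTop {t | P n t} := by
  simp only [leastOrTop_eq_encard]
  exact isRegularSeq_encard <|
    .all (.imp (hP.reindex ![some 0, none]) (.sum_lt_sum [some 1] [none]))

end LeastOrTop

section Factors

variable {Δ : Type*} {x : ℕ → Δ}

theorem length_factorAt (i n : ℕ) : (factorAt x i n).length = n := by simp [factorAt]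

theorem factorAt_add (i m n : ℕ) :
    factorAt x i (m + n) = factorAt x i m ++ factorAt x (i + m) n := by
  simp [factorAt, List.range_add, Function.comp_def, add_assoc]

theorem factorAt_eq_iff {i j n : ℕ} :
    factorAt x i n = factorAt x j n ↔ ∀ u w, i ≤ u → u < i + n → u + j = w + i → x u = x w := by
  simp only [factorAt, List.map_inj_left, List.mem_range]
  constructor
  · intro h u w hiu hun huw
    obtain ⟨m, rfl⟩ := Nat.exists_eq_add_of_le hiu
    obtain rfl : w = j + m := by lia
    exact h m (by lia)
  · exact fun h m hm => h _ _ (by lia) (by lia) (by lia)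

theorem factorAt_isInfix_iff {i j n t : ℕ} :
    factorAt x j n <:+: factorAt x i t ↔
      ∃ p, i ≤ p ∧ p + n ≤ i + t ∧ factorAt x j n = factorAt x p n := by
  constructor
  · rintro ⟨u, v, h⟩
    have ht : u.length + n + v.length = t := by
      simpa [length_factorAt, add_assoc] using congrArg List.length h
    rw [← ht, factorAt_add, factorAt_add] at h
    refine ⟨i + u.length, by lia, by lia, ?_⟩
    exact List.append_inj_right (List.append_inj_left h (by simp [length_factorAt]))
      (by simp [length_factorAt])
  · rintro ⟨p, hip, hpt, h⟩
    obtain ⟨q, rfl⟩ := Nat.exists_eq_add_of_le hip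
    obtain ⟨r, rfl⟩ : ∃ r, t = q + n + r := Nat.exists_eq_add_of_le (by lia)
    rw [h, factorAt_add, factorAt_add]
    exact ⟨_, _, rfl⟩

theorem finite_range_factorAt (hx : (Set.range x).Finite) (n : ℕ) :
    (Set.range fun i => factorAt x i n).Finite := by
  have : Finite (Set.range x) := hx
  refine ((List.finite_length_eq (Set.range x) n).image (List.map Subtype.val)).subset ?_
  rintro _ ⟨i, rfl⟩
  refine ⟨factorAt (Set.rangeFactorization x) i n, length_factorAt _ _, ?_⟩
  simp [factorAt, Function.comp_def, Set.rangeFactorization]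

theorem appearanceFunction_ne_top (hx : (Set.range x).Finite) (n : ℕ) :
    appearanceFunction x n ≠ ⊤ := by
  obtain ⟨I, -, hI, hrange⟩ := Set.Finite.exists_subset_finite_image_eq (s := Set.univ)
    (f := fun i => factorAt x i n) (by simpa using finite_range_factorAt hx n) subset_rfl
  obtain ⟨b, hb⟩ := hI.bddAbove
  refine leastOrTop_ne_top ⟨b + n, fun j => factorAt_isInfix_iff.2 ?_⟩
  obtain ⟨p, hp, hpj⟩ := hrange.symm ▸ Set.mem_image_of_mem (factorAt x · n) (Set.mem_univ j)
  exact ⟨p, p.zero_le, by have := hb hp; lia, hpj.symm⟩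

theorem repetitivityIndex_ne_top (hx : (Set.range x).Finite) (n : ℕ) :
    repetitivityIndex x n ≠ ⊤ := by
  classical
  obtain ⟨i, hex⟩ : ∃ i j, i < j ∧ factorAt x i n = factorAt x j n :=
    (finite_range_factorAt hx n).exists_lt_map_eq_of_forall_mem Set.mem_range_self
  obtain ⟨hij, heq⟩ := Nat.find_spec hex
  exact leastOrTop_ne_top ⟨Nat.find hex - i, i, Nat.find hex, hij, by lia, heq.symm,
    fun m him hm h => Nat.find_min hex hm ⟨him, h.symm⟩⟩

-- If no factor starting at `n` is new, then by the pigeonhole principle some earlier position `j`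
-- carries arbitrarily long factors that also start at `n`, so `n - j` is an eventual period.
theorem separatorLength_ne_top (hx : ¬ IsUltimatelyPeriodic x) (n : ℕ) :
    separatorLength x n ≠ ⊤ := by
  refine leastOrTop_ne_top (Set.nonempty_iff_ne_empty.2 fun hempty => hx ?_)
  have hrepeat (t : ℕ) : ∃ j : Fin n, factorAt x j t = factorAt x n t := by
    simpa [Fin.exists_iff] using Set.eq_empty_iff_forall_notMem.1 hempty t
  choose pos hpos using hrepeat
  obtain ⟨j, hj⟩ := Finite.exists_infinite_fiber pos
  refine ⟨n - j, j, by lia, fun m hm => ?_⟩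
  obtain ⟨t, rfl, hmt⟩ := (Set.infinite_coe_iff.1 hj).exists_gt m
  exact (factorAt_eq_iff.1 (hpos t) _ _ hm (by lia) (by lia)).symm

theorem separatorLength_zero (x : ℕ → Δ) : separatorLength x 0 = 0 :=
  leastOrTop_eq_of_isLeast (t := 0) ⟨by simp, fun _ _ => Nat.zero_le _⟩

end Factors

namespace IsAutomatic

variable {Δ : Type*} {x : ℕ → Δ} [k.AtLeastTwo]

section Formulas

variable {ι : Type*} [Finite ι]

theorem isRecognizable_factorAt_eq (hx : IsAutomatic k x) (i j n : ι) :
    IsRecognizable k fun v => factorAt x (v i) (v n) = factorAt x (v j) (v n) := by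
  simp only [factorAt_eq_iff]
  let old (l : ι) : Option (Option ι) := some (some l)
  let u : Option (Option ι) := some none
  let w : Option (Option ι) := none
  exact .all <| .all <| .imp (.sum_le_sum [old i] [u]) <| .imp (.sum_lt_sum [u] [old i, old n]) <|
    .imp (.sum_eq_sum [u, old j] [w, old i]) <| hx.isRecognizable_comp fun y => y u = y w

theorem isRecognizable_isInfix_factorAt (hx : IsAutomatic k x) (i j n t : ι) :
    IsRecognizable k fun v => factorAt x (v j) (v n) <:+: factorAt x (v i) (v t) := by
  simp only [factorAt_isInfix_iff]
  exact .ex <| .and (.sum_le_sum [some i] [none]) <|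
    .and (.sum_le_sum [none, some n] [some i, some t]) <|
    hx.isRecognizable_factorAt_eq (some j) none (some n)

end Formulas

theorem isRegularSeq_recurrenceFunction (hx : IsAutomatic k x) :
    IsRegularSeq ℕ∞ k (recurrenceFunction x) :=
  IsRecognizable.isRegularSeq_leastOrTop <| .all <| .all <|
    hx.isRecognizable_isInfix_factorAt (i := some none) (j := none) (n := some (some 0))
      (t := some (some 1))

theorem isRegularSeq_appearanceFunction (hx : IsAutomatic k x) :
    IsRegularSeq ℕ∞ k (appearanceFunction x) := by
  have hiff (j n t : ℕ) : factorAt x j n <:+: factorAt x 0 t ↔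
      ∃ p, p + n ≤ t ∧ factorAt x j n = factorAt x p n := by simp [factorAt_isInfix_iff]
  have hformula : IsRecognizable k fun v : Fin 2 → ℕ =>
      ∀ j, factorAt x j (v 0) <:+: factorAt x 0 (v 1) := by
    simp only [hiff]
    let n : Option (Option (Fin 2)) := some (some 0)
    let t : Option (Option (Fin 2)) := some (some 1)
    let j : Option (Option (Fin 2)) := some none
    let p : Option (Option (Fin 2)) := none
    exact .all <| .ex <| .and (.sum_le_sum [p, n] [t]) <| hx.isRecognizable_factorAt_eq j p n
  exact hformula.isRegularSeq_leastOrTop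

theorem isRegularSeq_separatorLength (hx : IsAutomatic k x) :
    IsRegularSeq ℕ∞ k (separatorLength x) :=
  IsRecognizable.isRegularSeq_leastOrTop <| .all <| .imp (.sum_lt_sum [none] [some 0]) <|
    .not <| hx.isRecognizable_factorAt_eq (i := none) (j := some 0) (n := some 1)

theorem isRegularSeq_repetitivityIndex (hx : IsAutomatic k x) :
    IsRegularSeq ℕ∞ k (repetitivityIndex x) :=
  IsRecognizable.isRegularSeq_leastOrTop <| .ex <| .ex <|
    let n : Option (Option (Fin 2)) := some (some 0)
    let d : Option (Option (Fin 2)) := some (some 1)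
    let i : Option (Option (Fin 2)) := some none
    let j : Option (Option (Fin 2)) := none
    .and (.sum_lt_sum [i] [j]) <| .and (.sum_eq_sum [j] [i, d]) <|
    .and (hx.isRecognizable_factorAt_eq j i n) <|
    .all <| .imp (.sum_lt_sum [some i] [none]) <| .imp (.sum_lt_sum [none] [some j]) <|
    .not <| hx.isRecognizable_factorAt_eq none (some i) (some n)

theorem isRegularSeq_of_eq_separatorLength (hx : IsAutomatic k x) {S : ℕ → ℕ∞}
    (hS : ∀ n, 1 ≤ n → S n = separatorLength x n) : IsRegularSeq ℕ∞ k S := by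
  have hsum : S = separatorLength x + Pi.single 0 (S 0) := by
    ext1 n
    rcases Nat.eq_zero_or_pos n with rfl | hn
    · simp [separatorLength_zero]
    · simp [hS n hn, hn.ne']
  rw [hsum]
  exact hx.isRegularSeq_separatorLength.add (isRegularSeq_single_zero _)

end IsAutomatic

theorem mainTheorem10 {Δ : Type*} (k : ℕ) (hk : 2 ≤ k) (x : ℕ → Δ) (hx : IsAutomatic k x) :
    -- the recurrence function
    IsRegularSeq ℕ∞ k (recurrenceFunction x) ∧
    -- the appearance function, which is finite
    (∃ A : ℕ → ℕ, (∀ n, appearanceFunction x n = (A n : ℕ∞)) ∧ IsRegularSeq ℕ k A) ∧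
    -- the separator length at positions n ≥ 1, with any value at n = 0:
    -- for arbitrary x with values in ℕ∞; finite and with values in ℕ unless x is
    -- ultimately periodic
    (∀ S : ℕ → ℕ∞, (∀ n, 1 ≤ n → S n = separatorLength x n) → IsRegularSeq ℕ∞ k S) ∧
    (¬ IsUltimatelyPeriodic x →
      (∀ n, separatorLength x n ≠ ⊤) ∧
      ∀ S : ℕ → ℕ, (∀ n, 1 ≤ n → (S n : ℕ∞) = separatorLength x n) → IsRegularSeq ℕ k S) ∧
    -- the repetitivity index, which is finite
    (∃ I : ℕ → ℕ, (∀ n, repetitivityIndex x n = (I n : ℕ∞)) ∧ IsRegularSeq ℕ k I) := by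
  have : k.AtLeastTwo := ⟨hk⟩
  have hfin := hx.finite_range
  exact ⟨hx.isRegularSeq_recurrenceFunction,
    hx.isRegularSeq_appearanceFunction.exists_natCast_eq (appearanceFunction_ne_top hfin),
    fun _ hS => hx.isRegularSeq_of_eq_separatorLength hS,
    fun hper => ⟨separatorLength_ne_top hper,
      fun _ hS => (hx.isRegularSeq_of_eq_separatorLength hS).of_natCast⟩,
    hx.isRegularSeq_repetitivityIndex.exists_natCast_eq (repetitivityIndex_ne_top hfin)⟩
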